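/- Let $k$ be a field, and let $H$ be a finite group acting by automorphisms on a group $\Gamma$. The smash coproduct $k[\Gamma]\rtimes k^H$ is the Hopf algebra which is $k[\Gamma]\otimes k^H$ as an algebra ($k[\Gamma]$ is the group algebra, $k^H$ the algebra of functions $H\to k$ with basis of indicator functions $(\delta_h)_{h\in H}$, and $r\#f$ denotes $r\otimes f$), with $$\Delta(r\#\delta_h)=\sum_{l\in H} r\#\delta_l\otimes l^{-1}.r\#\delta_{l^{-1}h},\qquad \varepsilon(r\#\delta_h)=\delta_{h,1},\qquad S(r\#\delta_h)=h^{-1}.r^{-1}\#\delta_{h^{-1}}.$$ A quotient datum is a triple $(G,N,\Phi)$ where $G\subset H$ is a subgroup, $N\triangleleft\Gamma$ is a normal $G$-stable subgroup, and $\Phi:N\to(k^G)^\times$ is a group morphism with $\Phi(r)(lh)=\Phi(l^{-1}.r)(h)\,\Phi(r)(l)$ and $\Phi(r)=\Phi(srs^{-1})$ for all $r\in N$, $s\in\Gamma$, $h,l\in G$. Let $u:\Gamma\to\Gamma/N$ be the canonical projection and $j:\Gamma/N\to\Gamma$ a section of $u$ with $j(u(1))=1$. Then $k[\Gamma/N]\rtimes_\Phi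 k^G$ denotes the Hopf algebra with underlying space $k[\Gamma/N]\otimes k^G$, unit $1\#1$, counit $\varepsilon(u(r)\#\delta_h)=\delta_{h,1}$, and $$(u(r)\#\delta_h)(u(s)\#\delta_g)=u(rs)\#\delta_h\delta_g\,\Phi\big(ju(r)\,ju(s)\,ju(rs)^{-1}\big),$$ $$\Delta(u(r)\#\delta_h)=\sum_{l\in G}\big(u(r)\#\delta_{l^{-1}}\big)\otimes \big(u(l.r)\#\delta_{lh}\,\Phi(l.ju(r)\;ju(l.r)^{-1})\big),$$ $$S(u(r)\#\delta_h)=u(h^{-1}.r^{-1})\#\Phi\big(ju(h^{-1}.r^{-1})^{-1}\;h^{-1}.ju(r)^{-1}\big)\delta_{h^{-1}};$$ up to isomorphism it does not depend on $j$. **Proposition 2.6.** Let $L$ be a Hopf algebra over $k$ and let $\pi:k[\Gamma]\rtimes k^H\to L$ be a surjective Hopf algebra map whose restriction to $k^H$, that is, the map $f\mapsto\pi(1\#f)$, is injective. Then there exists a quotient datum $(H,N,\Phi)$ (with $G=H$) such that $L$ is isomorphic, as a Hopf algebra, to $k[\Gamma/N]\rtimes_\Phi k^H$ (for every choice of $j$).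 More precisely, $$N=\{r\in\Gamma\mid \exists f\in(k^H)^\times,\ \pi(r\#1)=\pi(1\#f)\},$$ and for $r\in N$, $\Phi(r)$ is the unique $f\in(k^H)^\times$ such that $\pi(r\#1)=\pi(1\#f)$. -/

import Mathlib

open scoped TensorProduct

noncomputable section

attribute [local instance] Fintype.ofFinite

/-! ### The smash coproduct -/

/-- The underlying space `k[Γ] ⊗ k^H` of the smash coproduct of the group algebra `k[Γ]` by the
algebra `k^H` of functions on `H`. It is a type synonym, because its coalgebra structure
is not the tensor product one. -/
def SmashCoproduct (k Γ H : Type*) [Field k] [Group Γ] : Type _ :=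
  MonoidAlgebra k Γ ⊗[k] (H → k)

namespace SmashCoproduct

variable {k Γ H : Type*} [Field k] [Group Γ]

/-- As an algebra the smash coproduct is the tensor product `k[Γ] ⊗ k^H`. -/
instance : Ring (SmashCoproduct k Γ H) :=
  inferInstanceAs (Ring (MonoidAlgebra k Γ ⊗[k] (H → k)))

instance : Algebra k (SmashCoproduct k Γ H) :=
  inferInstanceAs (Algebra k (MonoidAlgebra k Γ ⊗[k] (H → k)))

/-- The element `r # f = r ⊗ f`, for `r ∈ Γ` and `f ∈ k^H`. -/
def tmul (r : Γ) (f : H → k) : SmashCoproduct k Γ H :=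
  (MonoidAlgebra.of k Γ r ⊗ₜ[k] f : MonoidAlgebra k Γ ⊗[k] (H → k))

theorem tmul_mul_tmul (r s : Γ) (f g : H → k) : tmul r f * tmul s g = tmul (r * s) (f * g) := by
  have : MonoidAlgebra.of k Γ (r * s) = MonoidAlgebra.of k Γ r * MonoidAlgebra.of k Γ s :=
    map_mul _ _ _
  unfold tmul
  rw [this]
  exact Algebra.TensorProduct.tmul_mul_tmul _ _ _ _

theorem one_def : (1 : SmashCoproduct k Γ H) = tmul 1 1 := by
  unfold tmul
  rw [map_one]
  rfl

/-- The basis of the elements `r # δ_h`. -/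
def basis (k Γ H : Type*) [Field k] [Group Γ] [Finite H] :
    Module.Basis (Γ × H) k (SmashCoproduct k Γ H) :=
  (MonoidAlgebra.basis Γ k).tensorProduct (Pi.basisFun k H)

theorem basis_apply [Finite H] [DecidableEq H] (r : Γ) (h : H) :
    basis k Γ H (r, h) = tmul r (Pi.single h 1) := by
  simp only [basis, tmul]
  refine (Module.Basis.tensorProduct_apply _ _ _ _).trans ?_
  rw [Pi.basisFun_apply]
  congr 1

theorem tmul_eq_sum [Finite H] (r : Γ) (f : H → k) :
    tmul r f = ∑ h, f h • basis k Γ H (r, h) := by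
  classical
  have h1 : f = ∑ h, f h • (Pi.single h 1 : H → k) := by
    ext x; simp [Finset.sum_apply, Pi.single_apply]
  simp only [basis_apply]
  conv_lhs => rw [h1]
  unfold tmul
  rw [TensorProduct.tmul_sum]
  exact Finset.sum_congr rfl fun h _ => TensorProduct.tmul_smul _ _ _

theorem basis_mul_basis [Finite H] [DecidableEq H] (p q : Γ × H) :
    basis k Γ H p * basis k Γ H q =
      if p.2 = q.2 then basis k Γ H (p.1 * q.1, p.2) else 0 := by
  obtain ⟨r, h⟩ := p
  obtain ⟨s, g⟩ := q
  rw [basis_apply, basis_apply, tmul_mul_tmul]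
  dsimp only
  split_ifs with hg
  · subst hg
    rw [basis_apply, ← Pi.single_mul, one_mul]
  · have : (Pi.single h 1 : H → k) * Pi.single g 1 = 0 := by
      ext x
      simp only [Pi.mul_apply, Pi.single_apply, Pi.zero_apply]
      split_ifs with h1 h2 <;> simp_all
    rw [this]
    exact TensorProduct.tmul_zero _ _

theorem one_eq_sum [Finite H] : (1 : SmashCoproduct k Γ H) = ∑ h, basis k Γ H (1, h) := by
  rw [one_def, tmul_eq_sum]; simp

variable [Group H] [Finite H] [MulDistribMulAction H Γ]

/-- The comultiplication: `Δ(r # δ_h) = ∑ l, (r # δ_l) ⊗ (l⁻¹.r # δ_{l⁻¹h})`. -/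
def comulMap (k Γ H : Type*) [Field k] [Group Γ] [Group H] [Finite H] [MulDistribMulAction H Γ] :
    SmashCoproduct k Γ H →ₗ[k] SmashCoproduct k Γ H ⊗[k] SmashCoproduct k Γ H :=
  (basis k Γ H).constr k fun p =>
    ∑ l : H, basis k Γ H (p.1, l) ⊗ₜ[k] basis k Γ H (l⁻¹ • p.1, l⁻¹ * p.2)

open Classical in
/-- The counit: `ε(r # δ_h) = δ_{h,1}`. -/
def counitMap (k Γ H : Type*) [Field k] [Group Γ] [Group H] [Finite H] :
    SmashCoproduct k Γ H →ₗ[k] k :=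
  (basis k Γ H).constr k fun p => if p.2 = 1 then 1 else 0

/-- The antipode: `S(r # δ_h) = h⁻¹.r⁻¹ # δ_{h⁻¹}`. -/
def antipodeMap (k Γ H : Type*) [Field k] [Group Γ] [Group H] [Finite H]
    [MulDistribMulAction H Γ] : SmashCoproduct k Γ H →ₗ[k] SmashCoproduct k Γ H :=
  (basis k Γ H).constr k fun p => basis k Γ H (p.2⁻¹ • p.1⁻¹, p.2⁻¹)

theorem comulMap_basis (p : Γ × H) : comulMap k Γ H (basis k Γ H p) =
    ∑ l : H, basis k Γ H (p.1, l) ⊗ₜ[k] basis k Γ H (l⁻¹ • p.1, l⁻¹ * p.2) :=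
  Module.Basis.constr_basis _ _ _ _

open Classical in
theorem counitMap_basis {H : Type*} [Group H] [Finite H] (p : Γ × H) :
    counitMap k Γ H (basis k Γ H p) = if p.2 = 1 then 1 else 0 :=
  Module.Basis.constr_basis _ _ _ _

theorem antipodeMap_basis (p : Γ × H) :
    antipodeMap k Γ H (basis k Γ H p) = basis k Γ H (p.2⁻¹ • p.1⁻¹, p.2⁻¹) :=
  Module.Basis.constr_basis _ _ _ _

instance : Coalgebra k (SmashCoproduct k Γ H) where
  comul := comulMap k Γ H
  counit := counitMap k Γ H
  coassoc := by
    refine (basis k Γ H).ext fun p => ?_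
    simp only [LinearMap.comp_apply, comulMap_basis, map_sum, LinearMap.rTensor_tmul,
      LinearMap.lTensor_tmul, TensorProduct.sum_tmul, TensorProduct.tmul_sum,
      LinearEquiv.coe_coe, TensorProduct.assoc_tmul]
    rw [Finset.sum_comm]
    refine Finset.sum_congr rfl fun m _ => ?_
    refine Fintype.sum_equiv (Equiv.mulLeft m⁻¹) _ _ fun l => ?_
    simp [mul_smul, mul_assoc]
  rTensor_counit_comp_comul := by
    classical
    refine (basis k Γ H).ext fun p => ?_
    simp only [LinearMap.comp_apply, comulMap_basis, map_sum, LinearMap.rTensor_tmul,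
      counitMap_basis, TensorProduct.mk_apply]
    rw [Finset.sum_eq_single 1] <;> simp +contextual
  lTensor_counit_comp_comul := by
    classical
    refine (basis k Γ H).ext fun p => ?_
    simp only [LinearMap.comp_apply, comulMap_basis, map_sum, LinearMap.lTensor_tmul,
      counitMap_basis, TensorProduct.mk_apply, LinearMap.flip_apply]
    rw [Finset.sum_eq_single p.2]
    · simp
    · intro b _ hb
      rw [if_neg, TensorProduct.tmul_zero]
      rw [inv_mul_eq_one]
      exact hb
    · simp

instance : Bialgebra k (SmashCoproduct k Γ H) where
  counit_one := by
    classical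
    change counitMap k Γ H 1 = 1
    simp [one_eq_sum, counitMap_basis]
  mul_compr₂_counit := by
    classical
    refine (basis k Γ H).ext fun p => (basis k Γ H).ext fun q => ?_
    change counitMap k Γ H (_ * _) = counitMap k Γ H _ * counitMap k Γ H _
    rw [basis_mul_basis, counitMap_basis, counitMap_basis]
    by_cases h : p.2 = q.2
    · rw [if_pos h, counitMap_basis]
      simp [h]
    · rw [if_neg h, map_zero]
      by_cases h1 : p.2 = 1
      · have h2 : q.2 ≠ 1 := fun h2 => h (h1.trans h2.symm)
        simp [h2]
      · simp [h1]
  comul_one := by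
    change comulMap k Γ H 1 = 1
    rw [Algebra.TensorProduct.one_def, one_eq_sum, map_sum, TensorProduct.sum_tmul]
    simp only [comulMap_basis, TensorProduct.tmul_sum]
    rw [Finset.sum_comm]
    refine Finset.sum_congr rfl fun l _ => ?_
    refine Fintype.sum_equiv (Equiv.mulLeft l⁻¹) _ _ fun h => ?_
    simp
  mul_compr₂_comul := by
    classical
    refine (basis k Γ H).ext fun p => (basis k Γ H).ext fun q => ?_
    change comulMap k Γ H (_ * _) = comulMap k Γ H _ * comulMap k Γ H _
    rw [basis_mul_basis, comulMap_basis, comulMap_basis, Finset.sum_mul_sum]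
    simp only [Algebra.TensorProduct.tmul_mul_tmul, basis_mul_basis]
    have : ∀ i : H, ∑ j : H, (if i = j then basis k Γ H (p.1 * q.1, i) else 0) ⊗ₜ[k]
        (if i⁻¹ * p.2 = j⁻¹ * q.2 then
          basis k Γ H ((i⁻¹ • p.1) * (j⁻¹ • q.1), i⁻¹ * p.2) else 0) =
        basis k Γ H (p.1 * q.1, i) ⊗ₜ[k] (if p.2 = q.2 then
          basis k Γ H (i⁻¹ • (p.1 * q.1), i⁻¹ * p.2) else 0) := by
      intro i
      rw [Finset.sum_eq_single i]
      · simp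
      · intro b _ hb
        rw [if_neg (Ne.symm hb), TensorProduct.zero_tmul]
      · simp
    simp only [this]
    split_ifs
    · rw [comulMap_basis]
    · simp

/-- The smash coproduct Hopf algebra `k[Γ] ⋊ k^H`. -/
instance : HopfAlgebra k (SmashCoproduct k Γ H) where
  antipode := antipodeMap k Γ H
  mul_antipode_rTensor_comul := by
    classical
    refine (basis k Γ H).ext fun p => ?_
    change LinearMap.mul' k _ ((antipodeMap k Γ H).rTensor _ (comulMap k Γ H _)) =
      algebraMap k _ (counitMap k Γ H _)
    simp only [comulMap_basis, map_sum, LinearMap.rTensor_tmul, antipodeMap_basis,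
      LinearMap.mul'_apply, basis_mul_basis, counitMap_basis]
    by_cases h : p.2 = 1
    · simp only [h, if_true, map_one, mul_one, one_eq_sum]
      refine Fintype.sum_equiv (Equiv.inv H) _ _ fun l => ?_
      simp
    · have h' : ∀ l : H, ¬ (l⁻¹ = l⁻¹ * p.2) := fun l hl => h (by simpa using hl)
      simp [h]
  mul_antipode_lTensor_comul := by
    classical
    refine (basis k Γ H).ext fun p => ?_
    change LinearMap.mul' k _ ((antipodeMap k Γ H).lTensor _ (comulMap k Γ H _)) =
      algebraMap k _ (counitMap k Γ H _)
    simp only [comulMap_basis, map_sum, LinearMap.lTensor_tmul, antipodeMap_basis,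
      LinearMap.mul'_apply, basis_mul_basis, counitMap_basis]
    by_cases h : p.2 = 1
    · simp only [h, if_true, map_one, mul_one, one_eq_sum]
      refine Finset.sum_congr rfl fun l _ => ?_
      simp
    · have h' : ∀ l : H, ¬ (l = (l⁻¹ * p.2)⁻¹) := fun l hl => h (by simpa using hl)
      simp only [if_neg (h' _), h]
      simp

end SmashCoproduct

/-! ### Quotient data -/

/-- A quotient datum `(G, N, Φ)` for an action of `H` by automorphisms on `Γ`: a subgroup `G` of
`H`, a normal and `G`-stable subgroup `N` of `Γ`, and a group morphism `Φ : N → (k^G)ˣ` with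
`Φ(r)(lh) = Φ(l⁻¹.r)(h) Φ(r)(l)` and `Φ(r) = Φ(srs⁻¹)`. -/
structure QuotientDatum (k Γ H : Type*) [Field k] [Group Γ] [Group H]
    [MulDistribMulAction H Γ] where
  G : Subgroup H
  N : Subgroup Γ
  normal : N.Normal
  stable : ∀ (l : G) (r : Γ), r ∈ N → l • r ∈ N
  Φ : N →* (G → k)ˣ
  map_mul' : ∀ (r : N) (l h : G), (Φ r : G → k) (l * h) =
    (Φ ⟨l⁻¹ • (r : Γ), stable l⁻¹ r r.2⟩ : G → k) h * (Φ r : G → k) l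
  map_conj' : ∀ (r : N) (s : Γ), Φ r = Φ ⟨s * r * s⁻¹, normal.conj_mem r r.2 s⟩

namespace QuotientDatum

variable {k Γ H : Type*} [Field k] [Group Γ] [Group H] [MulDistribMulAction H Γ]
  (D : QuotientDatum k Γ H)

instance : D.N.Normal := D.normal

/-- The action of `l ∈ G` on `Γ/N` induced by the action on `Γ`: `l.u(r) = u(l.r)`. -/
def act (l : D.G) : Γ ⧸ D.N →* Γ ⧸ D.N :=
  QuotientGroup.map D.N D.N (MulDistribMulAction.toMonoidHom Γ l) fun r hr => D.stable l r hr

theorem act_mk (l : D.G) (r : Γ) : D.act l (r : Γ ⧸ D.N) = ((l • r : Γ) : Γ ⧸ D.N) := rfl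

theorem act_one (x : Γ ⧸ D.N) : D.act 1 x = x := by
  induction x using QuotientGroup.induction_on with
  | H r => rw [act_mk, one_smul]

theorem act_mul (l m : D.G) (x : Γ ⧸ D.N) : D.act (l * m) x = D.act l (D.act m x) := by
  induction x using QuotientGroup.induction_on with
  | H r => rw [act_mk, act_mk, act_mk, mul_smul]

theorem map_smul_mul (n : D.G) (r : D.N) (h : D.G) :
    (D.Φ ⟨n • (r : Γ), D.stable n r r.2⟩ : D.G → k) (n * h) =
      (D.Φ r : D.G → k) h * (D.Φ ⟨n • (r : Γ), D.stable n r r.2⟩ : D.G → k) n := by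
  have := D.map_mul' ⟨n • (r : Γ), D.stable n r r.2⟩ n h
  simpa only [inv_smul_smul] using this

theorem map_apply_ne_zero (r : D.N) (h : D.G) : (D.Φ r : D.G → k) h ≠ 0 := by
  have : (D.Φ r : D.G → k) h * ((D.Φ r)⁻¹ : (D.G → k)ˣ).val h = 1 := by
    rw [← Pi.mul_apply, Units.mul_inv]; rfl
  exact left_ne_zero_of_mul (this ▸ one_ne_zero)

theorem map_apply_one (r : D.N) : (D.Φ r : D.G → k) 1 = 1 := by
  have h := D.map_mul' r 1 1
  simp only [inv_one, one_smul, mul_one] at h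
  have h0 := D.map_apply_ne_zero r 1
  exact (mul_left_cancel₀ h0 ((mul_one _).trans h)).symm

theorem map_smul_self (n : D.G) (r : D.N) :
    (D.Φ ⟨n • (r : Γ), D.stable n r r.2⟩ : D.G → k) n * (D.Φ r : D.G → k) n⁻¹ = 1 := by
  have := D.map_smul_mul n r n⁻¹
  rw [mul_inv_cancel, map_apply_one] at this
  rw [mul_comm]; exact this.symm

theorem map_eq_smul (n : D.G) (r : D.N) (h : D.G) :
    (D.Φ r : D.G → k) h = (D.Φ ⟨n • (r : Γ), D.stable n r r.2⟩ : D.G → k) (n * h) *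
      (D.Φ r : D.G → k) n⁻¹ := by
  rw [map_smul_mul, mul_assoc, map_smul_self, mul_one]

theorem map_mul_apply (r s : D.N) (h : D.G) :
    (D.Φ r : D.G → k) h * (D.Φ s : D.G → k) h = (D.Φ (r * s) : D.G → k) h := by
  rw [map_mul]; rfl

/-- A section `j : Γ/N → Γ` of the canonical projection `u`, normalized by `j(u(1)) = 1`. -/
structure NormalizedSection where
  toFun : Γ ⧸ D.N → Γ
  mk_toFun : ∀ x, (toFun x : Γ ⧸ D.N) = x
  toFun_one : toFun 1 = 1

variable {D} (j : D.NormalizedSection)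

namespace NormalizedSection

theorem mul_mem (x y : Γ ⧸ D.N) : j.toFun x * j.toFun y * (j.toFun (x * y))⁻¹ ∈ D.N := by
  rw [← QuotientGroup.eq_one_iff]
  simp [j.mk_toFun]

theorem smul_mem (l : D.G) (x : Γ ⧸ D.N) : (l • j.toFun x) * (j.toFun (D.act l x))⁻¹ ∈ D.N := by
  rw [← QuotientGroup.eq_one_iff]
  simp [← act_mk, j.mk_toFun]

theorem inv_mem (l : D.G) (x : Γ ⧸ D.N) :
    (j.toFun (D.act l x⁻¹))⁻¹ * (l • (j.toFun x)⁻¹) ∈ D.N := by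
  rw [← QuotientGroup.eq_one_iff]
  simp [← act_mk, j.mk_toFun]

/-- `Φ(j(x) j(y) j(xy)⁻¹) ∈ k^G`, for `x, y ∈ Γ/N`. -/
def mulFactor (x y : Γ ⧸ D.N) : D.G → k :=
  D.Φ ⟨j.toFun x * j.toFun y * (j.toFun (x * y))⁻¹, j.mul_mem x y⟩

/-- `Φ(l.j(x) j(l.x)⁻¹) ∈ k^G`, for `l ∈ G` and `x ∈ Γ/N`. -/
def comulFactor (l : D.G) (x : Γ ⧸ D.N) : D.G → k :=
  D.Φ ⟨(l • j.toFun x) * (j.toFun (D.act l x))⁻¹, j.smul_mem l x⟩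

/-- `Φ(j(l.x⁻¹)⁻¹ l.j(x)⁻¹) ∈ k^G`, for `l ∈ G` and `x ∈ Γ/N`. -/
def antipodeFactor (l : D.G) (x : Γ ⧸ D.N) : D.G → k :=
  D.Φ ⟨(j.toFun (D.act l x⁻¹))⁻¹ * (l • (j.toFun x)⁻¹), j.inv_mem l x⟩

theorem Φ_congr {a b : D.N} (h : (a : Γ) = b) (g : D.G) :
    (D.Φ a : D.G → k) g = (D.Φ b : D.G → k) g := by
  rw [Subtype.ext h]

theorem Φ_eq_one {a : D.N} (h : (a : Γ) = 1) (g : D.G) : (D.Φ a : D.G → k) g = 1 := by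
  have : a = 1 := Subtype.ext h
  rw [this, map_one]; rfl

theorem Φ_conj_apply (r : D.N) (s : Γ) (g : D.G) : (D.Φ r : D.G → k) g =
    (D.Φ ⟨s * r * s⁻¹, D.normal.conj_mem r r.2 s⟩ : D.G → k) g := by
  rw [← D.map_conj']

theorem mulFactor_assoc (x y z : Γ ⧸ D.N) (g : D.G) :
    j.mulFactor x y g * j.mulFactor (x * y) z g = j.mulFactor y z g * j.mulFactor x (y * z) g := by
  unfold mulFactor
  rw [map_mul_apply, Φ_conj_apply ⟨j.toFun y * _ * _, _⟩ (j.toFun x), map_mul_apply]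
  refine Φ_congr ?_ g
  simp only [Subgroup.coe_mul, mul_assoc x y z]
  group

theorem mulFactor_one_left (x : Γ ⧸ D.N) (g : D.G) : j.mulFactor 1 x g = 1 :=
  Φ_eq_one (by simp [j.toFun_one]) g

theorem mulFactor_one_right (x : Γ ⧸ D.N) (g : D.G) : j.mulFactor x 1 g = 1 :=
  Φ_eq_one (by simp [j.toFun_one]) g

theorem mulFactor_apply_one (x y : Γ ⧸ D.N) : j.mulFactor x y 1 = 1 := D.map_apply_one _

theorem comulFactor_apply_one (l : D.G) (x : Γ ⧸ D.N) : j.comulFactor l x 1 = 1 :=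
  D.map_apply_one _

theorem comulFactor_one_left (x : Γ ⧸ D.N) (g : D.G) : j.comulFactor 1 x g = 1 :=
  Φ_eq_one (by simp [act_one]) g

theorem comulFactor_one_right (l : D.G) (g : D.G) : j.comulFactor l 1 g = 1 :=
  Φ_eq_one (by simp [j.toFun_one]) g

theorem comulFactor_coassoc (n m h : D.G) (x : Γ ⧸ D.N) :
    j.comulFactor (n * m) x (n * m * h) * j.comulFactor m x n⁻¹ =
      j.comulFactor m x (m * h) * j.comulFactor n (D.act m x) (n * m * h) := by
  unfold comulFactor
  rw [D.map_eq_smul n ⟨(m • j.toFun x) * _, _⟩ (m * h), mul_right_comm, ← mul_assoc n m h,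
    map_mul_apply]
  congr 1
  refine Φ_congr ?_ _
  simp [act_mul, mul_smul]

theorem comulFactor_mul (l h : D.G) (x y : Γ ⧸ D.N) :
    j.mulFactor x y h * j.comulFactor l (x * y) (l * h) =
      j.comulFactor l x (l * h) * j.comulFactor l y (l * h) * j.mulFactor x y l⁻¹ *
        j.mulFactor (D.act l x) (D.act l y) (l * h) := by
  have e : ∀ a b c d : k, a * b * c * d = b * (a * d) * c := by intros; ring
  rw [e]
  unfold comulFactor mulFactor
  rw [D.map_eq_smul l _ h, mul_right_comm]
  rw [map_mul_apply, map_mul_apply, Φ_conj_apply ⟨(l • j.toFun y) * _, _⟩ (l • j.toFun x),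
    map_mul_apply]
  congr 1
  refine Φ_congr ?_ _
  simp [smul_mul', mul_assoc]

theorem antipode_left (l : D.G) (x : Γ ⧸ D.N) :
    j.antipodeFactor l x l * j.comulFactor l x l *
      j.mulFactor (D.act l x⁻¹) (D.act l x) l = 1 := by
  unfold antipodeFactor comulFactor mulFactor
  rw [map_mul_apply, Φ_conj_apply _ (j.toFun (D.act l x⁻¹)), map_mul_apply]
  refine Φ_eq_one ?_ _
  simp only [Subgroup.coe_mul, ← map_mul, inv_mul_cancel, map_one, j.toFun_one, smul_inv']
  group

theorem antipode_right (l : D.G) (x : Γ ⧸ D.N) :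
    j.comulFactor l x l * j.antipodeFactor l⁻¹ (D.act l x) l⁻¹ * j.mulFactor x x⁻¹ l⁻¹ = 1 := by
  have hx : D.act l⁻¹ (D.act l x)⁻¹ = x⁻¹ := by
    rw [← map_inv, ← act_mul, inv_mul_cancel, act_one]
  have hn : j.toFun x * (l⁻¹ • (j.toFun (D.act l x))⁻¹) ∈ D.N := by
    rw [← QuotientGroup.eq_one_iff]
    simp [← act_mk, j.mk_toFun, ← act_mul, act_one]
  have h1 : j.comulFactor l x l = (D.Φ ⟨l • (j.toFun x * (l⁻¹ • (j.toFun (D.act l x))⁻¹)),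
      D.stable l _ hn⟩ : D.G → k) l := by
    refine Φ_congr ?_ _
    simp
  have h2 : j.antipodeFactor l⁻¹ (D.act l x) l⁻¹ * j.mulFactor x x⁻¹ l⁻¹ =
      (D.Φ ⟨_, hn⟩ : D.G → k) l⁻¹ := by
    unfold antipodeFactor mulFactor
    rw [mul_comm, map_mul_apply]
    refine Φ_congr ?_ _
    simp [hx, j.toFun_one, mul_assoc]
  rw [mul_assoc, h2, h1]
  exact D.map_smul_self l ⟨_, hn⟩

end NormalizedSection

/-! ### The Hopf algebra of a quotient datum -/

/-- The vector space `k[Γ/N] ⊗ k^G`. -/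
abbrev TensorSpace (D : QuotientDatum k Γ H) : Type _ :=
  MonoidAlgebra k (Γ ⧸ D.N) ⊗[k] (D.G → k)

/-- The basis of `k[Γ/N] ⊗ k^G` given by the elements `x # δ_h = x ⊗ δ_h`, for `x ∈ Γ/N` and
`h ∈ G`. -/
def tensorBasis (D : QuotientDatum k Γ H) [Finite H] :
    Module.Basis ((Γ ⧸ D.N) × D.G) k D.TensorSpace :=
  (MonoidAlgebra.basis (Γ ⧸ D.N) k).tensorProduct (Pi.basisFun k D.G)

section mul

variable [Finite H]

open Classical in
/-- The multiplication of `k[Γ/N] ⋊_Φ k^G`, with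
`(x # δ_h)(y # δ_g) = xy # δ_h δ_g Φ(j(x) j(y) j(xy)⁻¹)`; here `δ_h δ_g` is `δ_h` if `h = g`
and `0` otherwise, and `δ_h f = f(h) δ_h`. -/
def mulMap : D.TensorSpace →ₗ[k] D.TensorSpace →ₗ[k] D.TensorSpace :=
  D.tensorBasis.constr k fun p => D.tensorBasis.constr k fun q =>
    if p.2 = q.2 then j.mulFactor p.1 q.1 p.2 • D.tensorBasis (p.1 * q.1, p.2) else 0

/-- The unit `1 # 1` of `k[Γ/N] ⋊_Φ k^G`, where `1 = ∑ h, δ_h` in `k^G`. -/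
def unit (D : QuotientDatum k Γ H) : D.TensorSpace := ∑ h : D.G, D.tensorBasis (1, h)

open Classical in
theorem mulMap_basis (p q : (Γ ⧸ D.N) × D.G) :
    mulMap j (D.tensorBasis p) (D.tensorBasis q) =
      if p.2 = q.2 then j.mulFactor p.1 q.1 p.2 • D.tensorBasis (p.1 * q.1, p.2) else 0 := by
  rw [mulMap, Module.Basis.constr_basis, Module.Basis.constr_basis]

theorem mulMap_one_left (a : D.TensorSpace) : mulMap j D.unit a = a := by
  suffices mulMap j D.unit = LinearMap.id from LinearMap.congr_fun this a
  refine D.tensorBasis.ext fun p => ?_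
  rw [LinearMap.id_apply, unit, map_sum, LinearMap.sum_apply]
  simp only [mulMap_basis]
  rw [Finset.sum_eq_single p.2] <;> simp +contextual [j.mulFactor_one_left]

theorem mulMap_one_right (a : D.TensorSpace) : mulMap j a D.unit = a := by
  suffices (mulMap j).flip D.unit = LinearMap.id from LinearMap.congr_fun this a
  refine D.tensorBasis.ext fun p => ?_
  rw [LinearMap.id_apply, LinearMap.flip_apply, unit, map_sum]
  simp only [mulMap_basis]
  rw [Finset.sum_eq_single p.2]
  · simp [j.mulFactor_one_right]
  · intro b _ hb
    rw [if_neg (Ne.symm hb)]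
  · simp

theorem mulMap_assoc (a b c : D.TensorSpace) :
    mulMap j (mulMap j a b) c = mulMap j a (mulMap j b c) := by
  suffices (mulMap j).compr₂ (mulMap j) = ((LinearMap.llcomp k D.TensorSpace D.TensorSpace
      D.TensorSpace).comp (mulMap j)).compl₂ (mulMap j) from
    LinearMap.congr_fun (LinearMap.congr_fun (LinearMap.congr_fun this a) b) c
  refine D.tensorBasis.ext fun p => D.tensorBasis.ext fun q => D.tensorBasis.ext fun r => ?_
  change mulMap j (mulMap j (D.tensorBasis p) (D.tensorBasis q)) (D.tensorBasis r) =
    mulMap j (D.tensorBasis p) (mulMap j (D.tensorBasis q) (D.tensorBasis r))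
  rw [mulMap_basis, mulMap_basis]
  by_cases h1 : p.2 = q.2 <;> by_cases h2 : q.2 = r.2
  · rw [if_pos h1, if_pos h2, map_smul, map_smul, LinearMap.smul_apply, mulMap_basis,
      mulMap_basis]
    simp only [h1, h2, if_true, smul_smul, mul_assoc]
    congr 1
    exact j.mulFactor_assoc _ _ _ _
  · rw [if_pos h1, if_neg h2, map_smul, map_zero, LinearMap.smul_apply, mulMap_basis]
    dsimp only
    rw [if_neg (h1 ▸ h2), smul_zero]
  · rw [if_neg h1, if_pos h2, map_smul, map_zero, LinearMap.zero_apply, mulMap_basis]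
    dsimp only
    rw [if_neg h1, smul_zero]
  · rw [if_neg h1, if_neg h2, map_zero, map_zero, LinearMap.zero_apply]

end mul

/-- The underlying space `k[Γ/N] ⊗ k^G` of the Hopf algebra `k[Γ/N] ⋊_Φ k^G` constructed
with the section `j`. It is a type synonym, because its Hopf algebra structure depends on `j`
and is not the tensor product one. -/
def TwistedSmash (_j : D.NormalizedSection) : Type _ := D.TensorSpace

namespace TwistedSmash

variable [Finite H]

instance : Ring (TwistedSmash j) where
  __ := (inferInstanceAs (AddCommGroup D.TensorSpace) : AddCommGroup (TwistedSmash j))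
  mul a b := mulMap j a b
  one := D.unit
  left_distrib a b c := map_add (mulMap j a) b c
  right_distrib a b c := LinearMap.map_add₂ (mulMap j) a b c
  zero_mul a := LinearMap.map_zero₂ (mulMap j) a
  mul_zero a := map_zero (mulMap j a)
  mul_assoc a b c := mulMap_assoc j a b c
  one_mul a := mulMap_one_left j a
  mul_one a := mulMap_one_right j a

instance : Algebra k (TwistedSmash j) :=
  letI : Module k (TwistedSmash j) := inferInstanceAs (Module k D.TensorSpace)
  Algebra.ofModule
    (fun r a b => LinearMap.map_smul₂ (mulMap j) r a b)
    (fun r a b => map_smul (mulMap j a) r b)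

/-- The basis of the elements `x # δ_h = x ⊗ δ_h`, for `x ∈ Γ/N` and `h ∈ G`. -/
def basis : Module.Basis ((Γ ⧸ D.N) × D.G) k (TwistedSmash j) := D.tensorBasis

open Classical in
theorem basis_mul_basis (p q : (Γ ⧸ D.N) × D.G) : basis j p * basis j q =
    if p.2 = q.2 then j.mulFactor p.1 q.1 p.2 • basis j (p.1 * q.1, p.2) else 0 :=
  mulMap_basis j p q

theorem one_def : (1 : TwistedSmash j) = ∑ h : D.G, basis j (1, h) := rfl

/-- The comultiplication, with
`Δ(x # δ_h) = ∑ l, (x # δ_{l⁻¹}) ⊗ (l.x # δ_{lh} Φ(l.j(x) j(l.x)⁻¹))`. -/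
def comulMap : TwistedSmash j →ₗ[k] TwistedSmash j ⊗[k] TwistedSmash j :=
  (basis j).constr k fun p => ∑ l : D.G,
    basis j (p.1, l⁻¹) ⊗ₜ[k] (j.comulFactor l p.1 (l * p.2) • basis j (D.act l p.1, l * p.2))

open Classical in
/-- The counit, with `ε(x # δ_h) = δ_{h,1}`. -/
def counitMap : TwistedSmash j →ₗ[k] k :=
  (basis j).constr k fun p => if p.2 = 1 then 1 else 0

/-- The antipode, with
`S(x # δ_h) = h⁻¹.x⁻¹ # Φ(j(h⁻¹.x⁻¹)⁻¹ h⁻¹.j(x)⁻¹) δ_{h⁻¹}`. -/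
def antipodeMap : TwistedSmash j →ₗ[k] TwistedSmash j :=
  (basis j).constr k fun p =>
    j.antipodeFactor p.2⁻¹ p.1 p.2⁻¹ • basis j (D.act p.2⁻¹ p.1⁻¹, p.2⁻¹)

theorem comulMap_basis (p : (Γ ⧸ D.N) × D.G) : comulMap j (basis j p) = ∑ l : D.G,
    basis j (p.1, l⁻¹) ⊗ₜ[k] (j.comulFactor l p.1 (l * p.2) • basis j (D.act l p.1, l * p.2)) :=
  Module.Basis.constr_basis _ _ _ _

open Classical in
theorem counitMap_basis (p : (Γ ⧸ D.N) × D.G) :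
    counitMap j (basis j p) = if p.2 = 1 then 1 else 0 :=
  Module.Basis.constr_basis _ _ _ _

theorem antipodeMap_basis (p : (Γ ⧸ D.N) × D.G) : antipodeMap j (basis j p) =
    j.antipodeFactor p.2⁻¹ p.1 p.2⁻¹ • basis j (D.act p.2⁻¹ p.1⁻¹, p.2⁻¹) :=
  Module.Basis.constr_basis _ _ _ _

instance : Coalgebra k (TwistedSmash j) where
  comul := comulMap j
  counit := counitMap j
  coassoc := by
    refine (basis j).ext fun p => ?_
    simp only [LinearMap.comp_apply, comulMap_basis, map_sum, LinearMap.rTensor_tmul,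
      LinearMap.lTensor_tmul, TensorProduct.sum_tmul, TensorProduct.tmul_sum,
      LinearEquiv.coe_coe, TensorProduct.assoc_tmul, map_smul, TensorProduct.tmul_smul,
      TensorProduct.smul_tmul', smul_smul, Finset.smul_sum]
    rw [Finset.sum_comm]
    refine Finset.sum_congr rfl fun m _ => ?_
    refine (Fintype.sum_equiv (Equiv.mulRight m) _ _ fun n => ?_).symm
    have hm : m * (n * m)⁻¹ = n⁻¹ := by group
    have hc := j.comulFactor_coassoc n m p.2 p.1
    simp only [Equiv.coe_mulRight, hm, ← TensorProduct.smul_tmul', TensorProduct.tmul_smul,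
      smul_smul, act_mul]
    rw [← mul_assoc n m p.2, hc, mul_comm]
  rTensor_counit_comp_comul := by
    refine (basis j).ext fun p => ?_
    simp only [LinearMap.comp_apply, comulMap_basis, map_sum, LinearMap.rTensor_tmul,
      counitMap_basis, TensorProduct.mk_apply]
    rw [Finset.sum_eq_single 1] <;> simp +contextual [j.comulFactor_one_left, act_one]
  lTensor_counit_comp_comul := by
    refine (basis j).ext fun p => ?_
    simp only [LinearMap.comp_apply, comulMap_basis, map_sum, LinearMap.lTensor_tmul,
      counitMap_basis, TensorProduct.mk_apply, LinearMap.flip_apply, map_smul]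
    rw [Finset.sum_eq_single p.2⁻¹]
    · simp [j.comulFactor_apply_one]
    · intro b _ hb
      rw [if_neg, smul_zero, TensorProduct.tmul_zero]
      rw [mul_eq_one_iff_eq_inv]
      exact hb
    · simp

theorem comul_eq : (Coalgebra.comul : TwistedSmash j →ₗ[k] _) = comulMap j := rfl

theorem counit_eq : (Coalgebra.counit : TwistedSmash j →ₗ[k] k) = counitMap j := rfl

theorem comulMap_mul (p q : (Γ ⧸ D.N) × D.G) :
    comulMap j (basis j p * basis j q) = comulMap j (basis j p) * comulMap j (basis j q) := by
  rw [basis_mul_basis, comulMap_basis, comulMap_basis, Finset.sum_mul_sum]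
  have key : ∀ l : D.G, ∑ m : D.G,
      (basis j (p.1, l⁻¹) ⊗ₜ[k]
        (j.comulFactor l p.1 (l * p.2) • basis j (D.act l p.1, l * p.2))) *
      (basis j (q.1, m⁻¹) ⊗ₜ[k]
        (j.comulFactor m q.1 (m * q.2) • basis j (D.act m q.1, m * q.2))) =
      (basis j (p.1, l⁻¹) ⊗ₜ[k]
        (j.comulFactor l p.1 (l * p.2) • basis j (D.act l p.1, l * p.2))) *
      (basis j (q.1, l⁻¹) ⊗ₜ[k]
        (j.comulFactor l q.1 (l * q.2) • basis j (D.act l q.1, l * q.2))) := by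
    intro l
    refine Finset.sum_eq_single l (fun b _ hb => ?_) (fun h => absurd (Finset.mem_univ l) h)
    rw [Algebra.TensorProduct.tmul_mul_tmul, basis_mul_basis,
      if_neg (fun h => hb (inv_injective h).symm), TensorProduct.zero_tmul]
  rw [Finset.sum_congr rfl fun l _ => key l]
  by_cases h : p.2 = q.2
  · rw [if_pos h, map_smul, comulMap_basis, Finset.smul_sum]
    refine Finset.sum_congr rfl fun l _ => ?_
    rw [Algebra.TensorProduct.tmul_mul_tmul, basis_mul_basis, smul_mul_smul_comm,
      basis_mul_basis, ← h, if_pos rfl, if_pos rfl, smul_smul, TensorProduct.tmul_smul,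
      TensorProduct.tmul_smul, ← TensorProduct.smul_tmul', smul_smul, smul_smul,
      j.comulFactor_mul l p.2 p.1 q.1, map_mul]
    congr 1
    ring
  · rw [if_neg h, map_zero]
    refine (Finset.sum_eq_zero fun l _ => ?_).symm
    rw [Algebra.TensorProduct.tmul_mul_tmul, smul_mul_smul_comm, basis_mul_basis j (_, l * _),
      if_neg (fun h' => h (mul_left_cancel h')), smul_zero, TensorProduct.tmul_zero]

instance : Bialgebra k (TwistedSmash j) where
  counit_one := by
    change counitMap j 1 = 1
    simp [one_def, counitMap_basis]
  mul_compr₂_counit := by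
    refine (basis j).ext fun p => (basis j).ext fun q => ?_
    change counitMap j (_ * _) = counitMap j _ * counitMap j _
    rw [basis_mul_basis, counitMap_basis, counitMap_basis]
    by_cases h : p.2 = q.2
    · rw [if_pos h, map_smul, counitMap_basis, ← h]
      by_cases h1 : p.2 = 1
      · simp [h1, j.mulFactor_apply_one]
      · simp [h1]
    · rw [if_neg h, map_zero]
      by_cases h1 : p.2 = 1
      · have h2 : q.2 ≠ 1 := fun h2 => h (h1.trans h2.symm)
        simp [h2]
      · simp [h1]
  comul_one := by
    change comulMap j 1 = 1
    rw [Algebra.TensorProduct.one_def, one_def, map_sum, TensorProduct.sum_tmul]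
    simp only [comulMap_basis, TensorProduct.tmul_sum]
    rw [Finset.sum_comm]
    refine Fintype.sum_equiv (Equiv.inv _) _ _ fun l => ?_
    refine Fintype.sum_equiv (Equiv.mulLeft l) _ _ fun h => ?_
    simp [j.comulFactor_one_right]
  mul_compr₂_comul := by
    refine (basis j).ext fun p => (basis j).ext fun q => ?_
    rw [LinearMap.compr₂_apply, LinearMap.compl₁₂_apply, LinearMap.mul_apply',
      LinearMap.mul_apply', comul_eq]
    exact comulMap_mul j p q

/-- The Hopf algebra `k[Γ/N] ⋊_Φ k^G`. -/
instance : HopfAlgebra k (TwistedSmash j) where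
  antipode := antipodeMap j
  mul_antipode_rTensor_comul := by
    refine (basis j).ext fun p => ?_
    change LinearMap.mul' k _ ((antipodeMap j).rTensor _ (comulMap j _)) =
      algebraMap k _ (counitMap j _)
    simp only [comulMap_basis, map_sum, LinearMap.rTensor_tmul, antipodeMap_basis,
      LinearMap.mul'_apply, basis_mul_basis, counitMap_basis, smul_mul_smul_comm, inv_inv]
    by_cases h : p.2 = 1
    · simp only [h, if_true, map_one, mul_one, one_def, smul_smul]
      refine Finset.sum_congr rfl fun l _ => ?_
      rw [j.antipode_left, one_smul, ← map_mul, inv_mul_cancel, map_one]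
    · simp [h]
  mul_antipode_lTensor_comul := by
    refine (basis j).ext fun p => ?_
    change LinearMap.mul' k _ ((antipodeMap j).lTensor _ (comulMap j _)) =
      algebraMap k _ (counitMap j _)
    simp only [comulMap_basis, map_sum, LinearMap.lTensor_tmul, antipodeMap_basis,
      LinearMap.mul'_apply, basis_mul_basis, counitMap_basis, map_smul, mul_smul_comm, smul_smul]
    by_cases h : p.2 = 1
    · simp only [h, if_true, map_one, mul_one, one_def, smul_smul]
      refine Fintype.sum_equiv (Equiv.inv _) _ _ fun l => ?_
      have hx : D.act l⁻¹ (D.act l p.1)⁻¹ = p.1⁻¹ := by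
        rw [← map_inv, ← act_mul, inv_mul_cancel, act_one]
      rw [hx, j.antipode_right, one_smul, mul_inv_cancel]
      rfl
    · have h' : ∀ l : D.G, ¬ (l⁻¹ = (l * p.2)⁻¹) := fun l hl => h (by simpa using hl)
      simp only [if_neg (h' _), h]
      simp

end TwistedSmash
end QuotientDatum
end

/-!
Multiplying `Δ(x)` on the left by `π(1 # δ_l) ⊗ 1` isolates one summand of the comultiplication:
it sends `π(r # δ_h)` to `π(r # δ_l) ⊗ π(l⁻¹.r # δ_{l⁻¹h})`. Applied to the relation
`π(r # 1) = π(1 # f)`, this gives the stability of `N` under `H` and the cocycle identity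
for `Φ`. For `l = h = 1` it makes the vectors `π(r # δ_1)` group-like, and they agree for two
elements of `Γ` exactly when `π(r # 1)` is a function for their quotient `r`; so representatives of
the distinct classes of `Γ/N` give linearly independent vectors. The case `l = 1` with `h` arbitrary
spreads this independence to all `π(ju(r) # δ_h)`, which are thus a basis of `L`.
-/

noncomputable section

attribute [local instance] Fintype.ofFinite

section LinearAlgebra

variable {R V W ι : Type*}

theorem linearIndependent_tmul {κ : ι → Type*} [CommRing R] [AddCommGroup V] [Module R V]
    [AddCommGroup W] [Module R W] [Module.Flat R W] {v : ι → V} (hv : LinearIndependent R v)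
    {w : ∀ i, κ i → W} (hw : ∀ i, LinearIndependent R (w i)) :
    LinearIndependent R fun p : Σ i, κ i => v p.1 ⊗ₜ[R] w p.1 p.2 := by
  classical
  have hinj : Function.Injective ((Finsupp.linearCombination R v).rTensor W ∘ₗ
      (TensorProduct.finsuppScalarLeft R W ι).symm.toLinearMap) :=
    (Module.Flat.rTensor_preserves_injective_linearMap _ hv).comp (LinearEquiv.injective _)
  convert (Finsupp.linearIndependent_single w hw).map_injOn _ hinj.injOn using 2 with p
  simp [TensorProduct.finsuppScalarLeft_symm_apply_single]

variable {K : Type*} [Field K] [AddCommGroup V] [Module K V] [AddCommGroup W] [Module K W]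

theorem tmul_right_injective {v : V} (hv : v ≠ 0) :
    Function.Injective fun w : W => v ⊗ₜ[K] w := by
  obtain ⟨φ, hφ⟩ := Module.Projective.exists_dual_eq_one K hv
  intro w w' h
  simpa [hφ] using congrArg (fun t => TensorProduct.lid K W (φ.rTensor W t)) h

theorem exists_eq_smul_of_tmul_eq_tmul {v v' : V} {w w' : W} (hw : w ≠ 0)
    (h : v ⊗ₜ[K] w = v' ⊗ₜ[K] w') : ∃ c : K, v = c • v' := by
  obtain ⟨φ, hφ⟩ := Module.Projective.exists_dual_eq_one K hw
  exact ⟨φ w', by simpa [hφ] using congrArg (fun t => TensorProduct.rid K V (φ.lTensor V t)) h⟩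

/-- `T` plays the role of a comultiplication, but it need have no counit; nonvanishing of the
group-like vectors replaces the condition `ε (v i) = 1`. -/
theorem linearIndependent_of_map_eq_tmul_self (T : V →ₗ[K] V ⊗[K] V) {v : ι → V}
    (hv : Function.Injective v) (hne : ∀ i, v i ≠ 0) (hT : ∀ i, T (v i) = v i ⊗ₜ v i) :
    LinearIndependent K v := by
  classical
  suffices ∀ s : Finset ι, LinearIndepOn K v (s : Set ι) from
    linearIndepOn_univ_iff.1 (linearIndepOn_iff_linearIndepOn_finset.2 fun s _ => this s)
  intro s
  induction s using Finset.induction_on with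
  | empty => simp
  | insert a s ha ih =>
    rw [Finset.coe_insert, linearIndepOn_insert (by simpa using ha)]
    refine ⟨ih, fun hmem => ?_⟩
    obtain ⟨c, hc⟩ := Submodule.mem_span_image_finset_iff_exists_fun K |>.1 hmem
    have hsum : ∑ i, c i • v i ⊗ₜ[K] (v i - v a) = 0 := by
      calc ∑ i, c i • v i ⊗ₜ[K] (v i - v a)
          = T (∑ i, c i • v i) - (∑ i, c i • v i) ⊗ₜ v a := by
            simp [hT, TensorProduct.tmul_sub, TensorProduct.sum_tmul, smul_sub,
              TensorProduct.smul_tmul']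
        _ = 0 := by rw [hc, hT, sub_self]
    have hli : LinearIndependent K fun i : s => v i ⊗ₜ[K] (v i - v a) := by
      have := linearIndependent_tmul ih (w := fun (i : s) (_ : Unit) => v i - v a) fun i =>
        .of_subsingleton () (sub_ne_zero.2 (hv.ne (ne_of_mem_of_not_mem i.2 ha)))
      exact this.comp (fun i => ⟨i, ()⟩) fun i j h => congrArg Sigma.fst h
    exact hne a (by simp [← hc, Fintype.linearIndependent_iff.1 hli c hsum])

end LinearAlgebra

namespace SmashCoproduct

section Algebra

variable {k Γ H : Type*} [Field k] [Group Γ]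

/-- The inclusion `r ↦ r # 1` of `Γ`. -/
def ofGroup : Γ →* SmashCoproduct k Γ H where
  toFun r := tmul r 1
  map_one' := rfl
  map_mul' r s := by rw [tmul_mul_tmul, mul_one]

/-- The inclusion `f ↦ 1 # f` of `k^H`. -/
def ofFun : (H → k) →ₐ[k] SmashCoproduct k Γ H :=
  (Algebra.TensorProduct.includeRight : (H → k) →ₐ[k] MonoidAlgebra k Γ ⊗[k] (H → k))

theorem ofGroup_mul_ofFun (r : Γ) (f : H → k) : ofGroup r * ofFun f = tmul r f := by
  change tmul r 1 * tmul 1 f = tmul r f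
  rw [tmul_mul_tmul, mul_one, one_mul]

theorem tmul_zero (r : Γ) : tmul r (0 : H → k) = 0 := by
  rw [← ofGroup_mul_ofFun, map_zero, mul_zero]

theorem tmul_smul (r : Γ) (c : k) (f : H → k) : tmul r (c • f) = c • tmul r f := by
  rw [← ofGroup_mul_ofFun, map_smul, mul_smul_comm, ofGroup_mul_ofFun]

variable {F A : Type*} [Semiring A] [FunLike F (SmashCoproduct k Γ H) A]
  [RingHomClass F (SmashCoproduct k Γ H) A] (π : F)

/-- The restriction of `π` to `k^H`. -/
def restrictFun : (H → k) →* A :=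
  (π : SmashCoproduct k Γ H →* A).comp (ofFun : (H → k) →ₐ[k] SmashCoproduct k Γ H)

/-- The subgroup `N` of those `r ∈ Γ` for which `π(r # 1)` is the image of an invertible
function on `H`. -/
def functionSubgroup : Subgroup Γ :=
  (Units.map (restrictFun π)).range.comap
    ((π : SmashCoproduct k Γ H →* A).comp ofGroup).toHomUnits

variable {π}

theorem mem_functionSubgroup {r : Γ} :
    r ∈ functionSubgroup π ↔ ∃ f : (H → k)ˣ, π (tmul r 1) = π (tmul 1 (f : H → k)) :=
  exists_congr fun _ => Units.ext_iff.trans eq_comm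

theorem map_tmul_mul_left {r : Γ} {f : H → k} (hr : π (tmul r 1) = π (tmul 1 f)) (s : Γ)
    (g : H → k) : π (tmul (r * s) g) = π (tmul s (f * g)) := by
  calc π (tmul (r * s) g) = π (tmul r 1) * π (tmul s g) := by
        rw [← map_mul, tmul_mul_tmul, one_mul]
    _ = π (tmul s (f * g)) := by rw [hr, ← map_mul, tmul_mul_tmul, one_mul]

theorem map_tmul_conj {r : Γ} {f : H → k} (hr : π (tmul r 1) = π (tmul 1 f)) (s : Γ) :
    π (tmul (s * r * s⁻¹) 1) = π (tmul 1 f) := by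
  calc π (tmul (s * r * s⁻¹) 1) = π (tmul s 1) * π (tmul (r * s⁻¹) 1) := by
        rw [← map_mul, tmul_mul_tmul, one_mul, mul_assoc]
    _ = π (tmul 1 f) := by
        rw [map_tmul_mul_left hr, ← map_mul, tmul_mul_tmul, mul_inv_cancel, one_mul, mul_one]

instance : (functionSubgroup π).Normal where
  conj_mem _ hr s := by
    obtain ⟨f, hf⟩ := mem_functionSubgroup.1 hr
    exact mem_functionSubgroup.2 ⟨f, map_tmul_conj hf s⟩

variable (hinj : Function.Injective fun f : H → k => π (tmul (1 : Γ) f))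
include hinj

theorem map_tmul_injective (r : Γ) : Function.Injective fun f : H → k => π (tmul r f) := by
  intro f g hfg
  refine hinj ?_
  simpa only [← map_mul, tmul_mul_tmul, inv_mul_cancel, one_mul] using
    congrArg (π (tmul r⁻¹ 1) * ·) hfg

theorem mem_functionSubgroup_of_map_tmul_eq {r : Γ} {f : H → k}
    (hr : π (tmul r 1) = π (tmul 1 f)) : r ∈ functionSubgroup π := by
  classical
  have hf : ∀ h, f h ≠ 0 := by
    intro h hfh
    have hzero : f * Pi.single h 1 = 0 := by
      rw [← Pi.single_mul_right, hfh, zero_mul, Pi.single_zero]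
    have := map_tmul_mul_left hr 1 (Pi.single h 1)
    rw [hzero, mul_one, tmul_zero, ← tmul_zero r] at this
    simpa using map_tmul_injective hinj r this
  exact mem_functionSubgroup.2 ⟨MulEquiv.piUnits.symm fun h => Units.mk0 (f h) (hf h), hr⟩

/-- The function `Φ(r)` determined by `π(r # 1) = π(1 # Φ(r))`, for `r` in the subgroup `N`. -/
def functionUnit : functionSubgroup π →* (H → k)ˣ :=
  (MonoidHom.ofInjective (Units.map_injective (f := restrictFun π) hinj)).symm.toMonoidHom.comp
    (MonoidHom.subgroupComap _ _)

theorem map_tmul_one_eq_map_functionUnit (r : functionSubgroup π) :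
    π (tmul (r : Γ) 1) = π (tmul 1 (functionUnit hinj r : H → k)) := by
  have hr : Units.map (restrictFun π) (functionUnit hinj r) =
      ((π : SmashCoproduct k Γ H →* A).comp ofGroup).toHomUnits r :=
    MonoidHom.apply_ofInjective_symm (Units.map_injective hinj) _
  exact congrArg Units.val hr.symm

theorem map_tmul_one_eq_iff (r : functionSubgroup π) {f : H → k} :
    π (tmul (r : Γ) 1) = π (tmul 1 f) ↔ f = functionUnit hinj r := by
  rw [map_tmul_one_eq_map_functionUnit hinj, eq_comm]
  exact hinj.eq_iff

theorem functionUnit_conj (r : functionSubgroup π) (s : Γ) : functionUnit hinj r =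
    functionUnit hinj ⟨s * r * s⁻¹, Subgroup.Normal.conj_mem inferInstance _ r.2 s⟩ :=
  Units.ext <| (map_tmul_one_eq_iff hinj _).1 <|
    map_tmul_conj (map_tmul_one_eq_map_functionUnit hinj r) s

end Algebra

section AlgHom

variable {k Γ H F A : Type*} [Field k] [Group Γ] [Finite H] [Ring A] [Algebra k A]
  [FunLike F (SmashCoproduct k Γ H) A] [AlgHomClass F k (SmashCoproduct k Γ H) A] {π : F}

theorem map_basis_mul {r : Γ} {f : H → k} (hr : π (tmul r 1) = π (tmul 1 f)) (s : Γ) (h : H) :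
    π (basis k Γ H (r * s, h)) = f h • π (basis k Γ H (s, h)) := by
  classical
  rw [basis_apply, map_tmul_mul_left hr, ← Pi.single_mul_right, mul_one, basis_apply, ← map_smul,
    ← tmul_smul, ← Pi.single_smul, smul_eq_mul, mul_one]

theorem map_tmul_one_eq_iff_forall_map_basis {r : Γ} {f : H → k} :
    π (tmul r 1) = π (tmul 1 f) ↔
      ∀ h, π (basis k Γ H (r, h)) = f h • π (basis k Γ H (1, h)) := by
  refine ⟨fun hr h => by rw [← map_basis_mul hr, mul_one], fun hr => ?_⟩
  rw [tmul_eq_sum, tmul_eq_sum, map_sum, map_sum]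
  exact Finset.sum_congr rfl fun h _ => by rw [Pi.one_apply, one_smul, map_smul, hr]

variable (hinj : Function.Injective fun f : H → k => π (tmul (1 : Γ) f))
include hinj

theorem linearIndependent_map_basis_left (r : Γ) :
    LinearIndependent k fun h : H => π (basis k Γ H (r, h)) := by
  rw [Fintype.linearIndependent_iff]
  intro c hc
  have hzero : π (tmul r c) = π (tmul r 0) := by
    simpa only [tmul_zero, map_zero, tmul_eq_sum r c, map_sum, map_smul] using hc
  exact congrFun (map_tmul_injective hinj r hzero)

theorem map_basis_ne_zero (p : Γ × H) : π (basis k Γ H p) ≠ 0 :=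
  (linearIndependent_map_basis_left hinj p.1).ne_zero p.2

end AlgHom

section Bialgebra

variable {k Γ H L : Type*} [Field k] [Group Γ] [Group H] [Finite H] [MulDistribMulAction H Γ]
  [Ring L] [Bialgebra k L] (π : SmashCoproduct k Γ H →ₐc[k] L)

/-- The map `x ↦ (π(1 # δ_l) ⊗ 1) Δ(x)`, which isolates one summand of the comultiplication. -/
def cornerComul (l : H) : L →ₗ[k] L ⊗[k] L :=
  LinearMap.mulLeft k (π (basis k Γ H (1, l)) ⊗ₜ[k] 1) ∘ₗ Coalgebra.comul

variable {π}

theorem comul_map_basis (r : Γ) (h : H) : Coalgebra.comul (R := k) (π (basis k Γ H (r, h))) =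
    ∑ l, π (basis k Γ H (r, l)) ⊗ₜ[k] π (basis k Γ H (l⁻¹ • r, l⁻¹ * h)) := by
  rw [← CoalgHomClass.map_comp_comul_apply]
  exact (congrArg _ (comulMap_basis (r, h))).trans (map_sum _ _ _)

theorem cornerComul_map_basis (l : H) (r : Γ) (h : H) :
    cornerComul π l (π (basis k Γ H (r, h))) =
      π (basis k Γ H (r, l)) ⊗ₜ π (basis k Γ H (l⁻¹ • r, l⁻¹ * h)) := by
  classical
  rw [cornerComul, LinearMap.comp_apply, comul_map_basis, LinearMap.mulLeft_apply, Finset.mul_sum,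
    Finset.sum_eq_single_of_mem l (Finset.mem_univ l)]
  · rw [Algebra.TensorProduct.tmul_mul_tmul, ← map_mul, basis_mul_basis, if_pos rfl, one_mul,
      one_mul]
  · intro m _ hml
    rw [Algebra.TensorProduct.tmul_mul_tmul, ← map_mul, basis_mul_basis, if_neg hml.symm, map_zero,
      TensorProduct.zero_tmul]

variable (hinj : Function.Injective fun f : H → k => π (tmul (1 : Γ) f))
include hinj

theorem map_tmul_inv_smul {r : Γ} {f : H → k} (hr : π (tmul r 1) = π (tmul 1 f)) {l : H}
    (hl : f l ≠ 0) : π (tmul (l⁻¹ • r) 1) = π (tmul 1 fun h => (f l)⁻¹ * f (l * h)) := by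
  rw [map_tmul_one_eq_iff_forall_map_basis] at hr ⊢
  intro h
  have hcorner := congrArg (cornerComul π l) (hr (l * h))
  rw [map_smul, cornerComul_map_basis, cornerComul_map_basis, hr l, inv_mul_cancel_left, smul_one,
    TensorProduct.smul_tmul, ← TensorProduct.tmul_smul] at hcorner
  rw [mul_smul, ← tmul_right_injective (map_basis_ne_zero hinj (1, l)) hcorner, inv_smul_smul₀ hl]

theorem smul_mem_functionSubgroup {r : Γ} (hr : r ∈ functionSubgroup π) (l : H) :
    l • r ∈ functionSubgroup π := by
  obtain ⟨f, hf⟩ := mem_functionSubgroup.1 hr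
  have hfl : (f : H → k) l⁻¹ ≠ 0 := (MulEquiv.piUnits f l⁻¹).ne_zero
  rw [← inv_inv l]
  exact mem_functionSubgroup_of_map_tmul_eq hinj (map_tmul_inv_smul hinj hf hfl)

theorem functionUnit_mul_apply (r : functionSubgroup π) (l h : H) :
    (functionUnit hinj r : H → k) (l * h) =
      (functionUnit hinj ⟨l⁻¹ • (r : Γ), smul_mem_functionSubgroup hinj r.2 l⁻¹⟩ : H → k) h *
        (functionUnit hinj r : H → k) l := by
  have hne : (functionUnit hinj r : H → k) l ≠ 0 :=
    (MulEquiv.piUnits (functionUnit hinj r) l).ne_zero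
  have hsmul := (map_tmul_one_eq_iff hinj ⟨_, smul_mem_functionSubgroup hinj r.2 l⁻¹⟩).1
    (map_tmul_inv_smul hinj (map_tmul_one_eq_map_functionUnit hinj r) hne)
  rw [← hsmul, mul_comm, mul_inv_cancel_left₀ hne]

theorem mem_functionSubgroup_of_map_basis_one_eq {r : Γ}
    (hr : π (basis k Γ H (r, 1)) = π (basis k Γ H (1, 1))) : r ∈ functionSubgroup π := by
  have hsmul : ∀ h : H, ∃ c : k, π (basis k Γ H (r, h)) = c • π (basis k Γ H (1, h)) := by
    intro h
    have hcorner := congrArg (cornerComul π h) hr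
    rw [cornerComul_map_basis, cornerComul_map_basis] at hcorner
    exact exists_eq_smul_of_tmul_eq_tmul (map_basis_ne_zero hinj _) hcorner
  choose c hc using hsmul
  exact mem_functionSubgroup_of_map_tmul_eq hinj
    (map_tmul_one_eq_iff_forall_map_basis.2 hc)

variable {ι : Type*} {t : ι → Γ} (ht : Function.Injective fun i => (t i : Γ ⧸ functionSubgroup π))
include ht

theorem linearIndependent_map_basis_one :
    LinearIndependent k fun i => π (basis k Γ H (t i, 1)) := by
  classical
  refine linearIndependent_of_map_eq_tmul_self (cornerComul π 1) (fun i j hij => ht ?_)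
    (fun i => map_basis_ne_zero hinj _) fun i => ?_
  · refine (QuotientGroup.eq.2 (mem_functionSubgroup_of_map_basis_one_eq hinj ?_)).symm
    have := congrArg (π (basis k Γ H ((t j)⁻¹, 1)) * ·) hij
    simpa only [← map_mul, basis_mul_basis, if_pos, inv_mul_cancel] using this
  · rw [cornerComul_map_basis, inv_one, one_smul, one_mul]

theorem linearIndependent_map_basis :
    LinearIndependent k fun p : ι × H => π (basis k Γ H (t p.1, p.2)) := by
  have hli := linearIndependent_tmul (linearIndependent_map_basis_one hinj ht)
    fun i => linearIndependent_map_basis_left hinj (t i)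
  have hcorner : cornerComul π 1 ∘ (fun p : ι × H => π (basis k Γ H (t p.1, p.2))) =
      (fun p : Σ _ : ι, H => π (basis k Γ H (t p.1, 1)) ⊗ₜ π (basis k Γ H (t p.1, p.2))) ∘
        (Equiv.sigmaEquivProd ι H).symm := by
    ext p
    rw [Function.comp_apply, cornerComul_map_basis, inv_one, one_smul, one_mul]
    rfl
  refine .of_comp (cornerComul π 1) ?_
  rw [hcorner]
  exact hli.comp _ (Equiv.injective _)

end Bialgebra

section Quotient

variable {k Γ H L : Type*} [Field k] [Group Γ] [Group H] [Finite H] [MulDistribMulAction H Γ]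
  [Ring L] [Bialgebra k L] {π : SmashCoproduct k Γ H →ₐc[k] L}
  (hinj : Function.Injective fun f : H → k => π (tmul (1 : Γ) f))

/-- The quotient datum `(H, N, Φ)` of a bialgebra map `π` which is injective on `k^H`, with `G = H`
encoded as the subgroup `⊤`. -/
def quotientDatum : QuotientDatum k Γ H where
  G := ⊤
  N := functionSubgroup π
  normal := inferInstance
  stable l _ hr := smul_mem_functionSubgroup hinj hr l
  Φ := (Units.map (MonoidHom.pi fun h : (⊤ : Subgroup H) =>
    Pi.evalMonoidHom (fun _ : H => k) h)).comp (functionUnit hinj)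
  map_mul' r l h := functionUnit_mul_apply hinj r l h
  map_conj' r s := congrArg (Units.map _) (functionUnit_conj hinj r s)

theorem map_basis_eq_smul {s t : Γ} (hst : s * t⁻¹ ∈ (quotientDatum hinj).N)
    (h : (quotientDatum hinj).G) : π (basis k Γ H (s, h)) =
      ((quotientDatum hinj).Φ ⟨s * t⁻¹, hst⟩ : _ → k) h • π (basis k Γ H (t, h)) := by
  have := map_basis_mul (map_tmul_one_eq_map_functionUnit hinj ⟨s * t⁻¹, hst⟩) t h
  rwa [inv_mul_cancel_right] at this

variable (j : (quotientDatum hinj).NormalizedSection)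

/-- The linear map `u(r) # δ_h ↦ π(ju(r) # δ_h)`. -/
def twistedSmashMap : QuotientDatum.TwistedSmash j →ₗ[k] L :=
  (QuotientDatum.TwistedSmash.basis j).constr k fun p => π (basis k Γ H (j.toFun p.1, p.2))

theorem twistedSmashMap_basis (p : (Γ ⧸ (quotientDatum hinj).N) × (quotientDatum hinj).G) :
    twistedSmashMap hinj j (QuotientDatum.TwistedSmash.basis j p) =
      π (basis k Γ H (j.toFun p.1, p.2)) :=
  Module.Basis.constr_basis _ _ _ _

theorem twistedSmashMap_one : twistedSmashMap hinj j 1 = 1 := by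
  rw [QuotientDatum.TwistedSmash.one_def, ← map_one π, one_eq_sum, map_sum, map_sum]
  refine Fintype.sum_equiv Subgroup.topEquiv.toEquiv _ _ fun h => ?_
  rw [twistedSmashMap_basis, j.toFun_one]
  rfl

theorem twistedSmashMap_mul (a b : QuotientDatum.TwistedSmash j) :
    twistedSmashMap hinj j (a * b) = twistedSmashMap hinj j a * twistedSmashMap hinj j b := by
  classical
  suffices (LinearMap.mul k (QuotientDatum.TwistedSmash j)).compr₂ (twistedSmashMap hinj j) =
      (LinearMap.mul k L).compl₁₂ (twistedSmashMap hinj j) (twistedSmashMap hinj j) from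
    LinearMap.congr_fun (LinearMap.congr_fun this a) b
  refine (QuotientDatum.TwistedSmash.basis j).ext fun p =>
    (QuotientDatum.TwistedSmash.basis j).ext fun q => ?_
  change twistedSmashMap hinj j (_ * _) = twistedSmashMap hinj j _ * twistedSmashMap hinj j _
  rw [QuotientDatum.TwistedSmash.basis_mul_basis, twistedSmashMap_basis, twistedSmashMap_basis,
    ← map_mul, basis_mul_basis]
  by_cases h : p.2 = q.2
  · rw [if_pos h, if_pos (congrArg Subtype.val h), map_smul, twistedSmashMap_basis]
    exact (map_basis_eq_smul hinj (j.mul_mem p.1 q.1) p.2).symm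
  · rw [if_neg h, if_neg (h <| Subtype.ext ·), map_zero, map_zero]

theorem counit_comp_twistedSmashMap :
    Coalgebra.counit ∘ₗ twistedSmashMap hinj j = Coalgebra.counit (R := k) := by
  classical
  refine (QuotientDatum.TwistedSmash.basis j).ext fun p => ?_
  rw [LinearMap.comp_apply, twistedSmashMap_basis, QuotientDatum.TwistedSmash.counit_eq,
    QuotientDatum.TwistedSmash.counitMap_basis, CoalgHomClass.counit_comp_apply]
  refine (counitMap_basis _).trans ?_
  simp only [OneMemClass.coe_eq_one]

theorem map_comp_comul_twistedSmashMap :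
    TensorProduct.map (twistedSmashMap hinj j) (twistedSmashMap hinj j) ∘ₗ Coalgebra.comul =
      Coalgebra.comul ∘ₗ twistedSmashMap hinj j := by
  refine (QuotientDatum.TwistedSmash.basis j).ext fun p => ?_
  rw [LinearMap.comp_apply, LinearMap.comp_apply, twistedSmashMap_basis,
    QuotientDatum.TwistedSmash.comul_eq, QuotientDatum.TwistedSmash.comulMap_basis,
    comul_map_basis, map_sum]
  refine Fintype.sum_equiv ((Equiv.inv _).trans Subgroup.topEquiv.toEquiv) _ _
    fun l : (quotientDatum hinj).G => ?_
  rw [TensorProduct.map_tmul, map_smul, twistedSmashMap_basis, twistedSmashMap_basis]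
  have hl : (((Equiv.inv _).trans Subgroup.topEquiv.toEquiv) l : H)⁻¹ = l := inv_inv (l : H)
  rw [hl]
  exact congrArg _ (map_basis_eq_smul hinj (j.smul_mem l p.1) (l * p.2)).symm

theorem twistedSmashMap_injective : Function.Injective (twistedSmashMap hinj j) := by
  have hj : Function.Injective fun x => (j.toFun x : Γ ⧸ functionSubgroup π) :=
    Function.LeftInverse.injective (g := id) j.mk_toFun
  exact Module.Basis.injective_constr_of_linearIndependent _ <|
    (linearIndependent_map_basis hinj hj).comp (Prod.map id Subtype.val)
      (Function.injective_id.prodMap Subtype.val_injective)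

theorem twistedSmashMap_surjective (hπ : Function.Surjective π) :
    Function.Surjective (twistedSmashMap hinj j) := by
  have hbasis : ∀ p, π (basis k Γ H p) ∈ LinearMap.range (twistedSmashMap hinj j) := by
    rintro ⟨r, h⟩
    have hr : r * (j.toFun (r : Γ ⧸ (quotientDatum hinj).N))⁻¹ ∈ (quotientDatum hinj).N := by
      rw [← QuotientGroup.eq_one_iff]
      simp [j.mk_toFun]
    rw [map_basis_eq_smul hinj hr ⟨h, Subgroup.mem_top h⟩, ← twistedSmashMap_basis hinj j (_, _)]
    exact Submodule.smul_mem _ _ (LinearMap.mem_range_self _ _)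
  intro y
  obtain ⟨x, rfl⟩ := hπ y
  have hle : ⊤ ≤ (LinearMap.range (twistedSmashMap hinj j)).comap
      (π : SmashCoproduct k Γ H →ₗ[k] L) :=
    (basis k Γ H).span_eq.ge.trans (Submodule.span_le.2 (Set.range_subset_iff.2 hbasis))
  exact hle (Submodule.mem_top (x := x))

/-- The isomorphism `k[Γ/N] ⋊_Φ k^H ≃ L`, for surjective `π`. -/
def twistedSmashEquiv (hπ : Function.Surjective π) :
    QuotientDatum.TwistedSmash j ≃ₐc[k] L :=
  .ofAlgEquiv
    (.ofBijective (.ofLinearMap (twistedSmashMap hinj j) (twistedSmashMap_one hinj j)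
      (twistedSmashMap_mul hinj j))
      ⟨twistedSmashMap_injective hinj j, twistedSmashMap_surjective hinj j hπ⟩)
    (AlgHom.ext <| LinearMap.congr_fun <| counit_comp_twistedSmashMap hinj j)
    (AlgHom.ext <| LinearMap.congr_fun <| map_comp_comul_twistedSmashMap hinj j)

end Quotient

end SmashCoproduct
end

theorem proposition2p6_general {k Γ H L : Type*} [Field k] [Group Γ] [Group H] [Finite H]
    [MulDistribMulAction H Γ] [Ring L] [Bialgebra k L]
    (π : SmashCoproduct k Γ H →ₐc[k] L) (hπ : Function.Surjective π)
    (hinj : Function.Injective fun f : H → k => π (SmashCoproduct.tmul (1 : Γ) f)) :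
    ∃ D : QuotientDatum k Γ H,
      D.G = ⊤ ∧
      (∀ r : Γ, r ∈ D.N ↔ ∃ f : (H → k)ˣ,
        π (SmashCoproduct.tmul r 1) = π (SmashCoproduct.tmul 1 (f : H → k))) ∧
      (∀ r : D.N, ∃ f : (H → k)ˣ,
        (∀ g : (H → k)ˣ,
          π (SmashCoproduct.tmul (r : Γ) 1) = π (SmashCoproduct.tmul 1 (g : H → k)) ↔ g = f) ∧
        ∀ h : D.G, (D.Φ r : D.G → k) h = (f : H → k) h) ∧
      ∀ j : D.NormalizedSection, Nonempty (D.TwistedSmash j ≃ₐc[k] L) := by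
  refine ⟨SmashCoproduct.quotientDatum hinj, rfl, fun _ => SmashCoproduct.mem_functionSubgroup,
    fun r => ⟨SmashCoproduct.functionUnit hinj r, fun g => ?_, fun _ => rfl⟩,
    fun j => ⟨SmashCoproduct.twistedSmashEquiv hinj j hπ⟩⟩
  rw [SmashCoproduct.map_tmul_one_eq_iff hinj r, Units.ext_iff]

/-- Let `π : k[Γ] ⋊ k^H → L` be a surjective Hopf algebra map which is injective on `k^H`. Then
there is a quotient datum `(H, N, Φ)` such that `N` is the set of all `r ∈ Γ` with
`π(r # 1) = π(1 # f)` for some `f ∈ (k^H)ˣ`, such that for `r ∈ N` the unique such `f` is `Φ(r)`,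
and such that `k[Γ/N] ⋊_Φ k^H`, constructed with any section `j`, is isomorphic to `L`. -/
theorem proposition2p6 {k Γ H L : Type*} [Field k] [Group Γ] [Group H] [Finite H]
    [MulDistribMulAction H Γ] [Ring L] [HopfAlgebra k L]
    (π : SmashCoproduct k Γ H →ₐc[k] L) (hπ : Function.Surjective π)
    (hinj : Function.Injective fun f : H → k => π (SmashCoproduct.tmul (1 : Γ) f)) :
    ∃ D : QuotientDatum k Γ H,
      D.G = ⊤ ∧
      (∀ r : Γ, r ∈ D.N ↔ ∃ f : (H → k)ˣ,
        π (SmashCoproduct.tmul r 1) = π (SmashCoproduct.tmul 1 (f : H → k))) ∧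
      (∀ r : D.N, ∃ f : (H → k)ˣ,
        (∀ g : (H → k)ˣ,
          π (SmashCoproduct.tmul (r : Γ) 1) = π (SmashCoproduct.tmul 1 (g : H → k)) ↔ g = f) ∧
        ∀ h : D.G, (D.Φ r : D.G → k) h = (f : H → k) h) ∧
      ∀ j : D.NormalizedSection, Nonempty (D.TwistedSmash j ≃ₐc[k] L) :=
  proposition2p6_general π hπ hinj
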